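/- Let $\mathbb{F}$ be a field of characteristic $0$. An operator monomial of degree $p$ and multiplicity $q$ is an associative word in $p$ occurrences of an argument symbol $*$, into which $q$ occurrences of a unary operator symbol $L$ (each applied to a nonempty subword) are inserted. For $a=(a_1,\dots,a_{10})$ let $$R_a=a_1L^3(**)+a_2L^2(L(*)*)+a_3L(L^2(*)*)+a_4L^3(*)*+a_5L^2(*L(*))+a_6L(L(*)L(*))+a_7L^2(*)L(*)+a_8L(*L^2(*))+a_9L(*)L^2(*)+a_{10}*L^3(*)$$ be the general operator polynomial of degree $2$ and multiplicity $3$. A consequence of $R_a$ is obtained from it by applying, in either order, one operation that raises the degree by one (replace the $i$-th argument symbol of every monomial by $**$, or multiply by $*$ on the right, or multiply by $*$ on the left) and one that raises the multiplicity by one (replace the $i$-th argument symbol of every monomial by $L(*)$, or apply $L$ to the whole expression). With $a_1,\dots,a_{10}$ indeterminate, there are $20$ distinct consequences; they are linear combinations of the $105$ operator monomials of degree $3$ and multiplicity $4$. Let $M$ be the $105\times 20$ matrix whose columns are their coefficient vectors, and for $a\in\mathbb{F}^{10}$ let $M_a$ be the matrix over $\mathbb{F}$ obtained by substituting the values $a$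 for the indeterminates. Let $a\in\mathbb{F}^{10}$ be nonzero, normalized so that its first nonzero entry is $1$. (1) $M_a$ has rank $16$ if and only if the identity $R_a=0$ is one of the following six: $$L^3(xy)=0,\quad L^3(xy)=xL^3(y),\quad L^3(xy)=L^3(x)y,\quad L^3(xy)=L^3(x)y+xL^3(y),\quad L^3(x)y=0,\quad xL^3(y)=0.$$ (2) $M_a$ has rank $19$ if and only if the identity $R_a=0$ is one of $$L^3(xy)+t\,L^2(xL(y))+t^2\,L(xL^2(y))+t^3\,xL^3(y)=0,\qquad L^3(xy)+t\,L^2(L(x)y)+t^2\,L(L^2(x)y)+t^3\,L^3(x)y=0,$$ where $t\in\{1,-1,i,-i\}\cap\mathbb{F}$ and $i^2=-1$. These are eight identities if $-1$ is a square in $\mathbb{F}$ (and only the four with $t=\pm1$ otherwise). (3) For every other normalized coefficient vector $a$, $M_a$ has full rank $20$. -/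

import Mathlib

/-- Operator monomials: nonempty associative words whose letters are the argument symbol `∗` and
`L(m)` for an operator monomial `m`.  Every monomial has exactly one such normal form:
`arg` is `∗`, `op m` is `L(m)`, `argMul m` is `∗ m`, and `opMul m n` is `L(m) n`. -/
inductive OpMon : Type
  | arg : OpMon
  | op : OpMon → OpMon
  | argMul : OpMon → OpMon
  | opMul : OpMon → OpMon → OpMon
  deriving DecidableEq

namespace OpMon

/-- The associative product of monomials (concatenation of words). -/
def mul : OpMon → OpMon → OpMon
  | arg, n => argMul n
  | op m, n => opMul m n
  | argMul m, n => argMul (mul m n)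
  | opMul m m', n => opMul m (mul m' n)

instance : Mul OpMon := ⟨mul⟩

/-- The degree: the number of argument symbols. -/
def degree : OpMon → ℕ
  | arg => 1
  | op m => m.degree
  | argMul m => m.degree + 1
  | opMul m n => m.degree + n.degree

/-- The multiplicity: the number of occurrences of the operator `L`. -/
def multiplicity : OpMon → ℕ
  | arg => 0
  | op m => m.multiplicity + 1
  | argMul m => m.multiplicity
  | opMul m n => m.multiplicity + 1 + n.multiplicity

/-- `substAt i w m` replaces the `i`-th argument symbol of `m` (counted from the left, starting
with `0`) by the monomial `w`. -/
def substAt : ℕ → OpMon → OpMon → OpMon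
  | i, w, arg => if i = 0 then w else arg
  | i, w, op m => op (substAt i w m)
  | i, w, argMul m => if i = 0 then w * m else argMul (substAt (i - 1) w m)
  | i, w, opMul m n =>
      if i < m.degree then opMul (substAt i w m) n else opMul m (substAt (i - m.degree) w n)

end OpMon

/-- The set of operator monomials of degree `p` and multiplicity `q`. -/
def operatorMonomials (p q : ℕ) : Set OpMon :=
  {m | m.degree = p ∧ m.multiplicity = q}

/-- The partial compositions with the product `B` that are available on monomials of degree `p`:
`m ∘ᵢ B` replaces the `i`-th argument by `∗∗`, `B ∘₁ m = m ∗`, and `B ∘₂ m = ∗ m`. -/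
def degreeSteps (p : ℕ) : Set (OpMon → OpMon) :=
  (fun i => OpMon.substAt i (OpMon.arg * OpMon.arg)) '' Set.Iio p ∪
    {fun m => m * OpMon.arg, fun m => OpMon.arg * m}

/-- The partial compositions with the operator `L` that are available on monomials of degree `p`:
`m ∘ᵢ L` replaces the `i`-th argument by `L(∗)`, and `L ∘ m = L(m)`. -/
def multiplicitySteps (p : ℕ) : Set (OpMon → OpMon) :=
  (fun i => OpMon.substAt i (OpMon.op OpMon.arg)) '' Set.Iio p ∪ {OpMon.op}

/-- Operator polynomials with coefficients in `S`. -/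
abbrev OpPoly (S : Type*) [CommRing S] := OpMon →₀ S

/-- The consequences of an operator polynomial `R` of degree `p`: apply (the linear extensions of)
two partial compositions, one raising the degree and one raising the multiplicity, in either
order. -/
noncomputable def consequences {S : Type*} [CommRing S] (p : ℕ) (R : OpPoly S) : Set (OpPoly S) :=
  Set.image2 (fun f g => (R.mapDomain f).mapDomain g) (degreeSteps p) (multiplicitySteps (p + 1)) ∪
    Set.image2 (fun g f => (R.mapDomain g).mapDomain f) (multiplicitySteps p) (degreeSteps p)

theorem consequences_finite {S : Type*} [CommRing S] (p : ℕ) (R : OpPoly S) :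
    (consequences p R).Finite := by
  have hd (k : ℕ) : (degreeSteps k).Finite :=
    ((Set.finite_Iio k).image _).union ((Set.finite_singleton _).insert _)
  have hm (k : ℕ) : (multiplicitySteps k).Finite :=
    ((Set.finite_Iio k).image _).union (Set.finite_singleton _)
  exact ((hd p).image2 _ (hm (p + 1))).union ((hm p).image2 _ (hd p))

noncomputable instance {S : Type*} [CommRing S] (p : ℕ) (R : OpPoly S) :
    Fintype (consequences p R) :=
  (consequences_finite p R).fintype

section Monomials
open OpMon

/-- The ten operator monomials of degree 2 and multiplicity 3, in lexicographic order:
`L³(∗∗)`, `L²(L(∗)∗)`, `L(L²(∗)∗)`, `L³(∗)∗`, `L²(∗L(∗))`,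
`L(L(∗)L(∗))`, `L²(∗)L(∗)`, `L(∗L²(∗))`, `L(∗)L²(∗)`, `∗L³(∗)`. -/
def monomials23 : Fin 10 → OpMon :=
  ![op (op (op (arg * arg))),
    op (op (op arg * arg)),
    op (op (op arg) * arg),
    op (op (op arg)) * arg,
    op (op (arg * op arg)),
    op (op arg * op arg),
    op (op arg) * op arg,
    op (arg * op (op arg)),
    op arg * op (op arg),
    arg * op (op (op arg))]

end Monomials

/-- The operator polynomial of degree 2 and multiplicity 3 with coefficients `a`. -/
noncomputable def identity23 {S : Type*} [CommRing S] (a : Fin 10 → S) : OpPoly S :=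
  ∑ k, Finsupp.single (monomials23 k) (a k)

/-- The general operator polynomial of degree 2 and multiplicity 3, with indeterminate
coefficients. -/
noncomputable def genericIdentity23 (F : Type*) [Field F] : OpPoly (MvPolynomial (Fin 10) F) :=
  identity23 MvPolynomial.X

/-- The matrix of consequences of the general operator polynomial.  The rows are indexed by the
operator monomials of degree 3 and multiplicity 4, the columns by the distinct consequences,
and the columns are the coefficient vectors of these consequences. -/
noncomputable def genericConsequenceMatrix (F : Type*) [Field F] :
    Matrix (operatorMonomials 3 4) (consequences 2 (genericIdentity23 F))
      (MvPolynomial (Fin 10) F) :=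
  Matrix.of fun m C => C.1 m.1

/-- The matrix of consequences with the values `a` substituted for the indeterminates. -/
noncomputable def consequenceMatrix {F : Type*} [Field F] (a : Fin 10 → F) :
    Matrix (operatorMonomials 3 4) (consequences 2 (genericIdentity23 F)) F :=
  (genericConsequenceMatrix F).map (MvPolynomial.eval a)

/-- The first nonzero coefficient is `1`. -/
def IsNormalized {F : Type*} [Field F] (a : Fin 10 → F) : Prop :=
  ∃ k, a k = 1 ∧ ∀ j < k, a j = 0

section Identities
open OpMon

/-- A monomial, regarded as an operator polynomial with coefficient `1`. -/
noncomputable def mono (F : Type*) [Field F] (m : OpMon) : OpPoly F := Finsupp.single m 1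

/-- The left-hand sides of the six identities `L³(xy) = 0`, `L³(xy) = x L³(y)`,
`L³(xy) = L³(x) y`, `L³(xy) = L³(x) y + x L³(y)`, `L³(x) y = 0`, `x L³(y) = 0`, with all terms
moved to the left. -/
noncomputable def rank16Identities (F : Type*) [Field F] : Set (OpPoly F) :=
  let L3xy := mono F (op (op (op (arg * arg))))
  let L3x_y := mono F (op (op (op arg)) * arg)
  let x_L3y := mono F (arg * op (op (op arg)))
  {L3xy, L3xy - x_L3y, L3xy - L3x_y, L3xy - (L3x_y + x_L3y), L3x_y, x_L3y}

/-- The four-term polynomial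
`L³(xy) + c₁ L²(x L(y)) + c₂ L(x L²(y)) + c₃ x L³(y)`. -/
noncomputable def fourTermRight {F : Type*} [Field F] (c₁ c₂ c₃ : F) : OpPoly F :=
  mono F (op (op (op (arg * arg)))) + c₁ • mono F (op (op (arg * op arg))) +
    c₂ • mono F (op (arg * op (op arg))) + c₃ • mono F (arg * op (op (op arg)))

/-- The four-term polynomial
`L³(xy) + c₁ L²(L(x) y) + c₂ L(L²(x) y) + c₃ L³(x) y`. -/
noncomputable def fourTermLeft {F : Type*} [Field F] (c₁ c₂ c₃ : F) : OpPoly F :=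
  mono F (op (op (op (arg * arg)))) + c₁ • mono F (op (op (op arg * arg))) +
    c₂ • mono F (op (op (op arg) * arg)) + c₃ • mono F (op (op (op arg)) * arg)

/-- The four-term identities with coefficients `±1`, and those with coefficients `±1, ±i` for
the square roots `i` of `-1` that lie in the field: eight identities when `-1` is a square. -/
noncomputable def rank19Identities (F : Type*) [Field F] : Set (OpPoly F) :=
  {fourTermRight 1 1 1, fourTermRight (-1) 1 (-1), fourTermLeft 1 1 1, fourTermLeft (-1) 1 (-1)} ∪
    {P | ∃ i : F, i ^ 2 = -1 ∧
      (P = fourTermRight i (-1) (-i) ∨ P = fourTermRight (-i) (-1) i ∨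
        P = fourTermLeft i (-1) (-i) ∨ P = fourTermLeft (-i) (-1) i)}

end Identities

/-! Write R(x,y) for the identity and D = L³. The rank is 20 minus the dimension of the space of
linear relations c among the consequences: sixteen come from R(xy,z), R(x,yz), R(x,y)z, xR(y,z) by
applying L to x, y, z or the whole, and the other four are R(L(xy),z), R(x,L(yz)), L(R(x,y))z,
xL(R(y,z)). Each row of the matrix is an equation with at most three terms a_k c_j.

Relations have two sources. If R = D(xy) + uD(x)y + v xD(y) with u, v in {0,-1}, then R(xy,z) -
R(x,yz) - uR(x,y)z + v xR(y,z) = 0. The four ways of applying L give four independent relations,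
hence rank 16; D(x)y and xD(y) behave likewise. If R is the left four-term identity with parameter
t, then L(R(x,y)) - tR(L(x),y) telescopes to L⁴(xy) - t⁴L⁴(x)y, and for t⁴ = 1 these differences
satisfy one relation, hence rank 19. See `isRelation_threeTermCoeff_iff` and
`isRelation_fourTermCoeff_iff`.

All other vectors are excluded by elimination (`IsRelation.eq_zero`), and reversal of words halves
the cases. -/

open OpMon

/-! ### Enumeration of the operator monomials. -/

namespace OpMon

/-- The operator monomials of degree `p` and multiplicity `q`, provided that `p + q ≤ n`. -/
def ofDegreeMultiplicity : ℕ → ℕ → ℕ → Finset OpMon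
  | 0, _, _ => ∅
  | n + 1, p, q =>
    (if p = 1 ∧ q = 0 then {arg} else ∅) ∪
      (match q with
        | 0 => ∅
        | q + 1 => (ofDegreeMultiplicity n p q).image op) ∪
      (match p with
        | 0 => ∅
        | p + 1 => (ofDegreeMultiplicity n p q).image argMul) ∪
      (match q with
        | 0 => ∅
        | q + 1 => (Finset.HasAntidiagonal.antidiagonal p ×ˢ Finset.HasAntidiagonal.antidiagonal q).biUnion fun x =>
            Finset.image₂ opMul (ofDegreeMultiplicity n x.1.1 x.2.1)
              (ofDegreeMultiplicity n x.1.2 x.2.2))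

theorem one_le_degree : ∀ m : OpMon, 1 ≤ m.degree
  | arg => le_rfl
  | op m => one_le_degree m
  | argMul _ => Nat.le_add_left _ _
  | opMul _ _ => (one_le_degree _).trans (Nat.le_add_right _ _)

theorem mem_ofDegreeMultiplicity {n p q : ℕ} (h : p + q ≤ n) (m : OpMon) :
    m ∈ ofDegreeMultiplicity n p q ↔ m.degree = p ∧ m.multiplicity = q := by
  induction n generalizing p q m with
  | zero =>
    have := one_le_degree m
    simp only [ofDegreeMultiplicity, Finset.notMem_empty, false_iff]
    omega
  | succ n ih =>
    simp only [ofDegreeMultiplicity, Finset.mem_union]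
    cases m with
    | arg =>
      rcases p with _ | p <;> rcases q with _ | q <;>
        simp [degree, multiplicity, apply_ite (arg ∈ ·)]
    | op m =>
      rcases p with _ | p <;> rcases q with _ | q <;>
        simp [degree, multiplicity, apply_ite (op m ∈ ·)]
      all_goals rw [ih (by omega)]
    | argMul m =>
      rcases p with _ | p <;> rcases q with _ | q <;>
        simp [degree, multiplicity, apply_ite (argMul m ∈ ·)]
      all_goals rw [ih (by omega)]
    | opMul m m' =>
      have hm := one_le_degree m
      have hm' := one_le_degree m'
      rcases q with _ | q
      · rcases p with _ | p <;> simp [degree, multiplicity, apply_ite (opMul m m' ∈ ·)]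
      · have key : opMul m m' ∈ (Finset.HasAntidiagonal.antidiagonal p ×ˢ Finset.HasAntidiagonal.antidiagonal q).biUnion
            (fun x => Finset.image₂ opMul (ofDegreeMultiplicity n x.1.1 x.2.1)
              (ofDegreeMultiplicity n x.1.2 x.2.2)) ↔
            m.degree + m'.degree = p ∧ m.multiplicity + m'.multiplicity = q := by
          simp only [Finset.mem_biUnion, Finset.mem_product, Finset.HasAntidiagonal.mem_antidiagonal,
            Finset.mem_image₂, opMul.injEq]
          constructor
          · rintro ⟨⟨⟨p₁, p₂⟩, q₁, q₂⟩, ⟨hp, hq⟩, m₁, h₁, m₂, h₂, rfl, rfl⟩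
            dsimp only at hp hq h₁ h₂
            rw [ih (by omega)] at h₁ h₂
            omega
          · rintro ⟨hp, hq⟩
            exact ⟨((m.degree, m'.degree), (m.multiplicity, m'.multiplicity)), ⟨hp, hq⟩,
              m, (ih (by dsimp only; omega) m).2 ⟨rfl, rfl⟩,
              m', (ih (by dsimp only; omega) m').2 ⟨rfl, rfl⟩, rfl, rfl⟩
        rw [key]
        rcases p with _ | p <;> simp [degree, multiplicity] <;> omega

end OpMon

theorem operatorMonomials_eq (p q : ℕ) :
    operatorMonomials p q = ofDegreeMultiplicity (p + q) p q := by
  ext m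
  rw [Finset.mem_coe, mem_ofDegreeMultiplicity le_rfl]
  rfl

theorem card_operatorMonomials_three_four : Nat.card (operatorMonomials 3 4) = 105 := by
  rw [operatorMonomials_eq, Nat.card_coe_set_eq, Set.ncard_coe_finset]
  decide +kernel

instance (p q : ℕ) : Finite (operatorMonomials p q) := by
  rw [operatorMonomials_eq]
  exact Finset.finite_toSet _

/-! ### The twenty consequences. -/

/-- The twenty compositions of partial compositions that produce the consequences of an operator
polynomial of degree 2, without repetitions. -/
def consequenceStep : Fin 20 → OpMon → OpMon :=
  ![fun m => substAt 0 (op arg) (substAt 0 (arg * arg) m),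
    fun m => substAt 1 (op arg) (substAt 0 (arg * arg) m),
    fun m => substAt 2 (op arg) (substAt 0 (arg * arg) m),
    fun m => op (substAt 0 (arg * arg) m),
    fun m => substAt 0 (op arg) (substAt 1 (arg * arg) m),
    fun m => substAt 1 (op arg) (substAt 1 (arg * arg) m),
    fun m => substAt 2 (op arg) (substAt 1 (arg * arg) m),
    fun m => op (substAt 1 (arg * arg) m),
    fun m => substAt 0 (op arg) (m * arg),
    fun m => substAt 1 (op arg) (m * arg),
    fun m => substAt 2 (op arg) (m * arg),
    fun m => op (m * arg),
    fun m => substAt 0 (op arg) (arg * m),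
    fun m => substAt 1 (op arg) (arg * m),
    fun m => substAt 2 (op arg) (arg * m),
    fun m => op (arg * m),
    fun m => substAt 0 (arg * arg) (substAt 0 (op arg) m),
    fun m => substAt 1 (arg * arg) (substAt 1 (op arg) m),
    fun m => op m * arg,
    fun m => arg * op m]

/-- The `k`-th monomial of the `j`-th consequence of a polynomial of degree 2 and multiplicity
3. -/
def consequenceMonomial (j : Fin 20) (k : Fin 10) : OpMon :=
  consequenceStep j (monomials23 k)

/-- The polynomial `∑ aₖ Tₖ`. -/
noncomputable def polyOf {S : Type*} [CommRing S] (a : Fin 10 → S) (T : Fin 10 → OpMon) :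
    OpPoly S :=
  ∑ k, Finsupp.single (T k) (a k)

theorem polyOf_apply {S : Type*} [CommRing S] (a : Fin 10 → S) (T : Fin 10 → OpMon) (m : OpMon) :
    polyOf a T m = ∑ k, if T k = m then a k else 0 := by
  simp [polyOf, Finsupp.finsetSum_apply, Finsupp.single_apply]

theorem mapDomain_polyOf {S : Type*} [CommRing S] (a : Fin 10 → S) (T : Fin 10 → OpMon)
    (f : OpMon → OpMon) : (polyOf a T).mapDomain f = polyOf a (f ∘ T) := by
  simp [polyOf, Finsupp.mapDomain_finsetSum, Finsupp.mapDomain_single]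

/-- The steps that raise the degree of a polynomial of degree 2. -/
def degreeStepTwo : Fin 4 → OpMon → OpMon :=
  ![substAt 0 (arg * arg), substAt 1 (arg * arg), fun m => m * arg, fun m => arg * m]

/-- The steps that raise the multiplicity of a polynomial of degree 2. -/
def multiplicityStepTwo : Fin 3 → OpMon → OpMon :=
  ![substAt 0 (op arg), substAt 1 (op arg), op]

/-- The steps that raise the multiplicity of a polynomial of degree 3. -/
def multiplicityStepThree : Fin 4 → OpMon → OpMon :=
  ![substAt 0 (op arg), substAt 1 (op arg), substAt 2 (op arg), op]

theorem degreeSteps_two : degreeSteps 2 = Set.range degreeStepTwo := by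
  have h : Set.Iio 2 = ({0, 1} : Set ℕ) := by ext; simp; omega
  ext f
  simp [degreeSteps, degreeStepTwo, h, eq_comm]
  tauto

theorem multiplicitySteps_two : multiplicitySteps 2 = Set.range multiplicityStepTwo := by
  have h : Set.Iio 2 = ({0, 1} : Set ℕ) := by ext; simp; omega
  ext f
  simp [multiplicitySteps, multiplicityStepTwo, h, eq_comm]
  tauto

theorem multiplicitySteps_three : multiplicitySteps 3 = Set.range multiplicityStepThree := by
  have h : Set.Iio 3 = ({0, 1, 2} : Set ℕ) := by ext; simp; omega
  ext f
  simp [multiplicitySteps, multiplicityStepThree, h, eq_comm]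
  tauto

/-- Of the 16 + 12 compositions, eight in the second group repeat one of the first, because
operations at independent places commute. The finite comparison is made on the ten monomials. -/
theorem consequences_identity23 {S : Type*} [CommRing S] (a : Fin 10 → S) :
    consequences 2 (identity23 a) = Set.range fun j => polyOf a (consequenceMonomial j) := by
  have h1 : ∀ x y, ∃ j, consequenceMonomial j =
      multiplicityStepThree y ∘ degreeStepTwo x ∘ monomials23 := by decide +kernel
  have h2 : ∀ x y, ∃ j, consequenceMonomial j =
      degreeStepTwo x ∘ multiplicityStepTwo y ∘ monomials23 := by decide +kernel
  have h3 : ∀ j, (∃ x y, multiplicityStepThree y ∘ degreeStepTwo x ∘ monomials23 =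
      consequenceMonomial j) ∨ ∃ y x, degreeStepTwo x ∘ multiplicityStepTwo y ∘ monomials23 =
      consequenceMonomial j := by decide +kernel
  have hid : identity23 a = polyOf a monomials23 := rfl
  rw [consequences, degreeSteps_two, multiplicitySteps_two, multiplicitySteps_three, hid]
  ext P
  simp only [Set.mem_union, Set.mem_image2, Set.mem_range, exists_exists_eq_and,
    mapDomain_polyOf]
  constructor
  · rintro (⟨x, y, rfl⟩ | ⟨y, x, rfl⟩)
    · obtain ⟨j, hj⟩ := h1 x y
      exact ⟨j, by rw [hj]⟩
    · obtain ⟨j, hj⟩ := h2 x y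
      exact ⟨j, by rw [hj]⟩
  · rintro ⟨j, rfl⟩
    obtain ⟨x, y, h⟩ | ⟨y, x, h⟩ := h3 j
    · exact Or.inl ⟨x, y, by rw [h]⟩
    · exact Or.inr ⟨y, x, by rw [h]⟩

theorem consequenceMonomial_injective_right (j : Fin 20) :
    Function.Injective (consequenceMonomial j) := by
  revert j
  unfold Function.Injective
  decide +kernel

theorem consequenceMonomial_injective : Function.Injective consequenceMonomial := by
  unfold Function.Injective
  decide +kernel

/-- This makes the number of columns exactly 20. Indeterminate coefficients matter: for special
values of the coefficients consequences may coincide. -/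
theorem polyOf_X_injective {F : Type*} [Field F] :
    Function.Injective fun j =>
      polyOf (MvPolynomial.X : Fin 10 → MvPolynomial (Fin 10) F) (consequenceMonomial j) := by
  intro i j hij
  apply consequenceMonomial_injective
  funext k
  have h := DFunLike.congr_fun hij (consequenceMonomial i k)
  simp only [polyOf_apply, (consequenceMonomial_injective_right i).eq_iff,
    Finset.sum_ite_eq', Finset.mem_univ, if_true] at h
  by_contra hne
  -- At the k-th unit vector the left side is 1, while on the right only the k-th term could
  -- survive, and `hne` excludes it.
  have h' := congrArg (MvPolynomial.eval (Pi.single k (1 : F))) h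
  simp only [MvPolynomial.eval_X, Pi.single_eq_same, map_sum, apply_ite, map_zero] at h'
  rw [Finset.sum_eq_zero] at h'
  · exact one_ne_zero h'
  · intro l _
    by_cases hl : l = k
    · subst hl
      rw [if_neg (Ne.symm hne)]
    · simp [Pi.single_eq_of_ne hl]

/-- The numbering of the distinct consequences of the general operator polynomial. -/
noncomputable def consequenceEquiv (F : Type*) [Field F] :
    Fin 20 ≃ consequences 2 (genericIdentity23 F) :=
  (Equiv.ofInjective _ polyOf_X_injective).trans
    (Equiv.setCongr (consequences_identity23 _).symm)

theorem consequenceEquiv_apply {F : Type*} [Field F] (j : Fin 20) :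
    (consequenceEquiv F j : OpPoly (MvPolynomial (Fin 10) F)) =
      polyOf MvPolynomial.X (consequenceMonomial j) := rfl

theorem card_consequences {F : Type*} [Field F] :
    Nat.card (consequences 2 (genericIdentity23 F)) = 20 := by
  rw [← Nat.card_congr (consequenceEquiv F), Nat.card_fin]

theorem consequenceMatrix_apply {F : Type*} [Field F] (a : Fin 10 → F)
    (m : operatorMonomials 3 4) (j : Fin 20) :
    consequenceMatrix a m (consequenceEquiv F j) =
      ∑ k, if consequenceMonomial j k = m then a k else 0 := by
  simp [consequenceMatrix, genericConsequenceMatrix, consequenceEquiv_apply, polyOf_apply,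
    apply_ite]

/-! ### The linear system for the relations. -/

/-- The pairs `(j, k)`, grouped by the value of `consequenceMonomial j k`: the nonzero rows of the
matrix of consequences. -/
def rowPairs : List (List (Fin 20 × Fin 10)) :=
  [[(0, 1)], [(0, 5)], [(0, 7)], [(0, 8)], [(1, 1)], [(1, 4)], [(1, 5)], [(1, 8)], [(5, 1)],
   [(5, 4)], [(5, 5)], [(5, 6)], [(6, 2)], [(6, 4)], [(6, 5)], [(6, 6)], [(10, 2)], [(10, 5)],
   [(10, 6)], [(10, 7)], [(11, 2)], [(11, 5)], [(11, 7)], [(11, 8)], [(12, 2)], [(12, 5)],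
   [(12, 7)], [(12, 8)], [(15, 2)], [(15, 5)], [(15, 6)], [(15, 7)], [(0, 2), (11, 1)],
   [(0, 4), (6, 1)], [(0, 6), (10, 1)], [(0, 9), (12, 9)], [(1, 0), (5, 0)], [(1, 2), (11, 4)],
   [(1, 6), (10, 4)], [(1, 7), (15, 8)], [(2, 4), (3, 7)], [(2, 6), (16, 8)], [(2, 8), (16, 9)],
   [(2, 9), (14, 9)], [(3, 0), (7, 0)], [(3, 1), (16, 0)], [(3, 2), (16, 1)], [(4, 1), (7, 2)],
   [(4, 3), (8, 3)], [(4, 6), (17, 3)], [(4, 8), (17, 6)], [(5, 2), (11, 6)], [(5, 7), (15, 1)],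
   [(5, 8), (12, 1)], [(6, 3), (10, 3)], [(6, 7), (15, 4)], [(6, 8), (12, 4)], [(7, 4), (17, 0)],
   [(7, 7), (17, 4)], [(8, 1), (18, 2)], [(8, 2), (18, 3)], [(8, 8), (9, 6)], [(9, 4), (18, 7)],
   [(9, 7), (18, 9)], [(9, 9), (13, 3)], [(10, 8), (12, 6)], [(11, 9), (15, 3)],
   [(13, 1), (19, 2)], [(13, 2), (19, 3)], [(13, 8), (14, 6)], [(14, 4), (19, 7)],
   [(14, 7), (19, 9)], [(16, 3), (18, 0)], [(17, 9), (19, 0)], [(0, 0), (4, 0), (7, 1)],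
   [(0, 3), (8, 0), (18, 1)], [(1, 3), (9, 0), (18, 4)], [(1, 9), (13, 9), (14, 8)],
   [(2, 0), (3, 4), (6, 0)], [(2, 1), (3, 5), (16, 4)], [(2, 2), (3, 6), (16, 5)],
   [(2, 3), (10, 0), (16, 6)], [(2, 5), (3, 8), (16, 7)], [(2, 7), (3, 9), (15, 9)],
   [(3, 3), (11, 0), (16, 2)], [(4, 2), (7, 3), (11, 3)], [(4, 4), (7, 5), (17, 1)],
   [(4, 5), (7, 6), (17, 2)], [(4, 7), (7, 8), (17, 5)], [(4, 9), (12, 0), (17, 8)],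
   [(5, 3), (8, 6), (9, 3)], [(5, 9), (13, 0), (19, 1)], [(6, 9), (14, 0), (19, 4)],
   [(7, 9), (15, 0), (17, 7)], [(8, 4), (9, 1), (18, 5)], [(8, 5), (9, 2), (18, 6)],
   [(8, 7), (9, 5), (18, 8)], [(8, 9), (9, 8), (12, 3)], [(10, 9), (13, 6), (14, 3)],
   [(13, 4), (14, 1), (19, 5)], [(13, 5), (14, 2), (19, 6)], [(13, 7), (14, 5), (19, 8)]]

/-- With `rowPairs_sound`, this certifies that the table consists of the fibres of
`consequenceMonomial`. -/
theorem rowPairs_complete (p : Fin 20 × Fin 10) :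
    ((List.finRange 20 ×ˢ List.finRange 10).filter fun q =>
      consequenceMonomial q.1 q.2 = consequenceMonomial p.1 p.2) ∈ rowPairs := by
  revert p
  decide +kernel

theorem rowPairs_sound : ∀ l ∈ rowPairs, ∃ p : Fin 20 × Fin 10,
    l = (List.finRange 20 ×ˢ List.finRange 10).filter fun q =>
      consequenceMonomial q.1 q.2 = consequenceMonomial p.1 p.2 := by
  decide +kernel

/-- `c` is a linear relation between the consequences of `identity23 a`. -/
def IsRelation {F : Type*} [Field F] (a : Fin 10 → F) (c : Fin 20 → F) : Prop :=
  ∀ l ∈ rowPairs, (l.map fun p => a p.2 * c p.1).sum = 0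

theorem sum_ite_eq_filter_sum {F : Type*} [Field F] (a : Fin 10 → F) (c : Fin 20 → F)
    (m : OpMon) :
    ∑ j, (∑ k, if consequenceMonomial j k = m then a k else 0) * c j =
      (((List.finRange 20 ×ˢ List.finRange 10).filter fun q =>
        consequenceMonomial q.1 q.2 = m).map fun p => a p.2 * c p.1).sum := by
  have hl : ∀ l : List (Fin 20 × Fin 10),
      ((l.filter fun q => consequenceMonomial q.1 q.2 = m).map fun p => a p.2 * c p.1).sum =
        (l.map fun q => if consequenceMonomial q.1 q.2 = m then a q.2 * c q.1 else 0).sum := by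
    intro l
    induction l with
    | nil => rfl
    | cons q l ih =>
      by_cases h : consequenceMonomial q.1 q.2 = m <;> simp [h, ih]
  have hnd : (List.finRange 20 ×ˢ List.finRange 10).Nodup :=
    (List.nodup_finRange 20).product (List.nodup_finRange 10)
  have hu : (List.finRange 20 ×ˢ List.finRange 10).toFinset = Finset.univ := by
    ext ⟨j, k⟩
    simp
  rw [hl, ← List.sum_toFinset _ hnd, hu, Fintype.sum_prod_type]
  refine Finset.sum_congr rfl fun j _ => ?_
  rw [Finset.sum_mul]
  simp [ite_mul]

theorem mulVec_eq_zero_iff {F : Type*} [Field F] (a : Fin 10 → F) (c : Fin 20 → F) :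
    ((consequenceMatrix a).submatrix id (consequenceEquiv F)).mulVec c = 0 ↔ IsRelation a c := by
  have hrow (m : operatorMonomials 3 4) :
      ((consequenceMatrix a).submatrix id (consequenceEquiv F)).mulVec c m =
        (((List.finRange 20 ×ˢ List.finRange 10).filter fun q =>
          consequenceMonomial q.1 q.2 = m).map fun p => a p.2 * c p.1).sum := by
    rw [← sum_ite_eq_filter_sum]
    simp [Matrix.mulVec, dotProduct, consequenceMatrix_apply]
  rw [funext_iff]
  simp only [hrow, Pi.zero_apply]
  constructor
  · intro h l hl
    obtain ⟨p, rfl⟩ := rowPairs_sound l hl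
    have hp : consequenceMonomial p.1 p.2 ∈ operatorMonomials 3 4 := by
      unfold operatorMonomials
      rw [Set.mem_ofPred_eq]
      revert p
      decide +kernel
    exact h ⟨_, hp⟩
  · rintro h ⟨m, hm⟩
    -- A monomial that occurs in no consequence gives a zero row, which imposes no condition.
    by_cases hex : ∃ p : Fin 20 × Fin 10, consequenceMonomial p.1 p.2 = m
    · obtain ⟨p, rfl⟩ := hex
      exact h _ (rowPairs_complete p)
    · push Not at hex
      rw [List.filter_eq_nil_iff.2]
      · rfl
      · intro p _
        simpa using hex p

theorem rank_add_finrank_ker {F : Type*} [Field F] (a : Fin 10 → F) :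
    (consequenceMatrix a).rank + Module.finrank F (LinearMap.ker
      ((consequenceMatrix a).submatrix id (consequenceEquiv F)).mulVecLin) = 20 := by
  have h1 : ((consequenceMatrix a).submatrix id (consequenceEquiv F)).rank =
      (consequenceMatrix a).rank :=
    Matrix.rank_submatrix _ (Equiv.refl _) (consequenceEquiv F)
  rw [← h1, Matrix.rank, LinearMap.finrank_range_add_finrank_ker, Module.finrank_fin_fun]

/-- If the relations between the consequences are parametrized by an injective linear map from
`F ^ n`, then the matrix of consequences has rank `20 - n`. -/
theorem rank_of_isRelation_iff {F : Type*} [Field F] {a : Fin 10 → F} {n : ℕ}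
    (f : (Fin n → F) →ₗ[F] Fin 20 → F) (hf : ∀ x, f x = 0 → x = 0)
    (h : ∀ c, IsRelation a c ↔ ∃ x, f x = c) : (consequenceMatrix a).rank + n = 20 := by
  have hker : LinearMap.ker
      ((consequenceMatrix a).submatrix id (consequenceEquiv F)).mulVecLin = LinearMap.range f := by
    ext c
    rw [LinearMap.mem_ker, Matrix.mulVecLin_apply, mulVec_eq_zero_iff, h, LinearMap.mem_range]
  have hr := rank_add_finrank_ker a
  rwa [hker, LinearMap.finrank_range_of_inj ((injective_iff_map_eq_zero f).2 hf),
    Module.finrank_fin_fun] at hr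

/-! ### Reversal symmetry. -/

/-- The action of the reversal of words on the coefficients of an identity. -/
def reverseCoeff : Fin 10 → Fin 10 := ![0, 4, 7, 9, 1, 5, 8, 2, 6, 3]

/-- The action of the reversal of words on the consequences. -/
def reverseConsequence : Fin 20 → Fin 20 :=
  ![6, 5, 4, 7, 2, 1, 0, 3, 14, 13, 12, 15, 10, 9, 8, 11, 17, 16, 19, 18]

theorem reverseCoeff_reverseCoeff : ∀ k, reverseCoeff (reverseCoeff k) = k := by decide

theorem reverseConsequence_reverseConsequence :
    ∀ j, reverseConsequence (reverseConsequence j) = j := by decide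

/-- Reversing words only permutes the monomials, hence the rows of the system. -/
theorem IsRelation.reverse {F : Type*} [Field F] {a : Fin 10 → F} {c : Fin 20 → F}
    (h : IsRelation a c) : IsRelation (a ∘ reverseCoeff) (c ∘ reverseConsequence) := by
  have key : ∀ l ∈ rowPairs, ∃ l' ∈ rowPairs,
      (l.map fun p => (reverseConsequence p.1, reverseCoeff p.2)).Perm l' := by decide +kernel
  intro l hl
  obtain ⟨l', hl', hp⟩ := key l hl
  rw [← h l' hl', ← (hp.map fun p => a p.2 * c p.1).sum_eq, List.map_map]
  rfl

theorem isRelation_comp_reverse_iff {F : Type*} [Field F] {a : Fin 10 → F} {c : Fin 20 → F} :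
    IsRelation (a ∘ reverseCoeff) (c ∘ reverseConsequence) ↔ IsRelation a c := by
  refine ⟨fun h => ?_, IsRelation.reverse⟩
  have h' := h.reverse
  have ha : (a ∘ reverseCoeff) ∘ reverseCoeff = a :=
    funext fun k => congrArg a (reverseCoeff_reverseCoeff k)
  have hc : (c ∘ reverseConsequence) ∘ reverseConsequence = c :=
    funext fun j => congrArg c (reverseConsequence_reverseConsequence j)
  rwa [ha, hc] at h'

/-! ### Elimination: coefficient vectors without nontrivial relations. -/

section Relations

variable {F : Type*} [Field F] {a : Fin 10 → F} {c : Fin 20 → F}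

/-- One-term rows with a_1 kill c_0, c_1, c_5; the vanishing of a_0 shortens further rows so that
the other entries follow successively. -/
theorem IsRelation.eq_zero_of_coeff_zero (h : IsRelation a c) (h1 : a 1 ≠ 0) (h0 : a 0 = 0) :
    c = 0 := by
  suffices ∀ j, c j = 0 from funext this
  simp only [IsRelation, rowPairs, List.forall_mem_cons, List.map, List.sum_cons, List.sum_nil,
    add_zero] at h
  simp only [Fin.forall_fin_succ]
  by_cases h4 : a 4 = 0
  · grind
  · grind

/-- All entries are multiples of c_3, the coefficient of L(R(xy,z)). If c_3 ≠ 0, the rows force the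
binomial pattern a_2 = a_1², a_5 = 2a_1a_4, a_6 = 3a_1²a_4, a_3 = a_1³. The row of L³(xy)L(z) then
reads -4a_1³a_4c_3 = 0, impossible in characteristic 0. -/
theorem IsRelation.eq_zero_of_two_sided [CharZero F] (h : IsRelation a c) (h1 : a 1 ≠ 0)
    (h4 : a 4 ≠ 0) (h0 : a 0 = 1) : c = 0 := by
  suffices ∀ j, c j = 0 from funext this
  simp only [IsRelation, rowPairs, List.forall_mem_cons, List.map, List.sum_cons, List.sum_nil,
    add_zero] at h
  simp only [Fin.forall_fin_succ]
  grind

/-- Again everything is a multiple of c_3. If c_3 ≠ 0, the rows force the geometric progression 1,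
a_1, a_1², a_1³ and the vanishing of the remaining coefficients; the row of L³(L(x))yz then gives
a_1⁴ = 1. -/
theorem IsRelation.eq_zero_of_one_sided (h : IsRelation a c) (h1 : a 1 ≠ 0) (h4 : a 4 = 0)
    (h0 : a 0 = 1) (hc : ¬(a 5 = 0 ∧ a 6 = 0 ∧ a 7 = 0 ∧ a 8 = 0 ∧ a 9 = 0 ∧ a 2 = a 1 ^ 2 ∧
      a 3 = a 1 ^ 3 ∧ a 1 ^ 4 = 1)) : c = 0 := by
  suffices ∀ j, c j = 0 from funext this
  simp only [IsRelation, rowPairs, List.forall_mem_cons, List.map, List.sum_cons, List.sum_nil,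
    add_zero] at h
  simp only [Fin.forall_fin_succ]
  grind

/-- A nonzero coefficient among these five has one-term rows, which start the elimination. The case
split selects such a coefficient; in the innermost branch it is a_8. -/
theorem IsRelation.eq_zero_of_mixed (h : IsRelation a c) (h1 : a 1 = 0) (h4 : a 4 = 0)
    (hc : ¬(a 2 = 0 ∧ a 5 = 0 ∧ a 6 = 0 ∧ a 7 = 0 ∧ a 8 = 0)) : c = 0 := by
  suffices ∀ j, c j = 0 from funext this
  simp only [IsRelation, rowPairs, List.forall_mem_cons, List.map, List.sum_cons, List.sum_nil,
    add_zero] at h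
  simp only [Fin.forall_fin_succ]
  by_cases h5 : a 5 = 0
  · by_cases h2 : a 2 = 0
    · by_cases h7 : a 7 = 0
      · by_cases h6 : a 6 = 0
        · grind
        · grind
      · grind
    · grind
  · grind

/-- Eliminating through D(xyz) and D(xy)z, the coefficient of D(x)yz becomes a_3(a_3 + 1) times an
entry of c, up to sign. This happens for each of the four ways of applying L. -/
theorem IsRelation.eq_zero_of_coeff_three (h : IsRelation a c) (h0 : a 0 = 1) (h1 : a 1 = 0)
    (h2 : a 2 = 0) (h4 : a 4 = 0) (h6 : a 6 = 0) (h7 : a 7 = 0) (h8 : a 8 = 0)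
    (h3 : a 3 ≠ 0) (h3' : a 3 ≠ -1) : c = 0 := by
  suffices ∀ j, c j = 0 from funext this
  simp only [IsRelation, rowPairs, List.forall_mem_cons, List.map, List.sum_cons, List.sum_nil,
    add_zero] at h
  simp only [Fin.forall_fin_succ]
  grind

theorem IsRelation.eq_zero_of_coeff_three_nine (h : IsRelation a c) (h0 : a 0 = 0) (h1 : a 1 = 0)
    (h2 : a 2 = 0) (h4 : a 4 = 0) (h6 : a 6 = 0) (h7 : a 7 = 0) (h8 : a 8 = 0)
    (h3 : a 3 ≠ 0) (h9 : a 9 ≠ 0) : c = 0 := by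
  suffices ∀ j, c j = 0 from funext this
  simp only [IsRelation, rowPairs, List.forall_mem_cons, List.map, List.sum_cons, List.sum_nil,
    add_zero] at h
  simp only [Fin.forall_fin_succ]
  grind

theorem comp_reverseConsequence_eq_zero (h : c ∘ reverseConsequence = 0) : c = 0 := by
  funext j
  simpa [reverseConsequence_reverseConsequence] using congrFun h (reverseConsequence j)

end Relations

/-! ### The exceptional identities and their spaces of relations. -/

section Coefficients

variable {F : Type*} [Field F]

/-- The coefficients of `L³(xy) + t L²(L(x) y) + t² L(L²(x) y) + t³ L³(x) y`. -/
def fourTermCoeff (t : F) : Fin 10 → F := ![1, t, t ^ 2, t ^ 3, 0, 0, 0, 0, 0, 0]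

/-- The coefficients of `L³(xy) + u L³(x) y + v x L³(y)`. -/
def threeTermCoeff (u v : F) : Fin 10 → F := ![1, 0, 0, u, 0, 0, 0, 0, 0, v]

/-- The coefficients of `L³(x) y`. -/
def leftTermCoeff (F : Type*) [Field F] : Fin 10 → F := ![0, 0, 0, 1, 0, 0, 0, 0, 0, 0]

/-- The coefficients of `x L³(y)`. -/
def rightTermCoeff (F : Type*) [Field F] : Fin 10 → F := ![0, 0, 0, 0, 0, 0, 0, 0, 0, 1]

/-- The coefficients of the identities in `rank16Identities`. -/
def rank16Coeffs (F : Type*) [Field F] : Set (Fin 10 → F) :=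
  {threeTermCoeff 0 0, threeTermCoeff 0 (-1), threeTermCoeff (-1) 0, threeTermCoeff (-1) (-1),
    leftTermCoeff F, rightTermCoeff F}

/-- The coefficients of the identities in `rank19Identities`. -/
def rank19Coeffs (F : Type*) [Field F] : Set (Fin 10 → F) :=
  fourTermCoeff '' {t | t ^ 4 = 1} ∪ (fun t => fourTermCoeff t ∘ reverseCoeff) '' {t | t ^ 4 = 1}

/-- The relation between the consequences of the four-term identity with parameter `t`. -/
def fourTermRelation (t : F) : Fin 20 → F :=
  ![0, 0, 0, 1, t, 0, 0, -1, -t, 0, 0, 0, 0, 0, 0, 0, -t, 0, 1, 0]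

/-- The relations `v ⊗ x`. -/
def tensorRelation (v : Fin 4 → F) : (Fin 4 → F) →ₗ[F] Fin 20 → F where
  toFun x := ![v 0 * x 0, v 0 * x 1, v 0 * x 2, v 0 * x 3, v 1 * x 0, v 1 * x 1, v 1 * x 2,
    v 1 * x 3, v 2 * x 0, v 2 * x 1, v 2 * x 2, v 2 * x 3, v 3 * x 0, v 3 * x 1, v 3 * x 2,
    v 3 * x 3, 0, 0, 0, 0]
  map_add' x y := by simp [mul_add]
  map_smul' r x := by simp [mul_left_comm]

theorem tensorRelation_apply (v x : Fin 4 → F) : tensorRelation v x =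
    ![v 0 * x 0, v 0 * x 1, v 0 * x 2, v 0 * x 3, v 1 * x 0, v 1 * x 1, v 1 * x 2,
      v 1 * x 3, v 2 * x 0, v 2 * x 1, v 2 * x 2, v 2 * x 3, v 3 * x 0, v 3 * x 1, v 3 * x 2,
      v 3 * x 3, 0, 0, 0, 0] := rfl

/-- Put E(x,y) = L(R(x,y)) - tR(L(x),y) = L⁴(xy) - t⁴L⁴(x)y. For t⁴ = 1, E(xy,z) - E(x,yz) + E(x,y)z
= 0, which is `fourTermRelation`. Conversely, the rows express every entry through c_3. -/
theorem isRelation_fourTermCoeff_iff {t : F} (ht : t ^ 4 = 1) {c : Fin 20 → F} :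
    IsRelation (fourTermCoeff t) c ↔ ∃ x : F, x • fourTermRelation t = c := by
  have ht0 : t ≠ 0 := by
    rintro rfl
    simp at ht
  simp only [IsRelation, rowPairs, List.forall_mem_cons, List.map, List.sum_cons, List.sum_nil,
    add_zero, fourTermCoeff, funext_iff, Fin.forall_fin_succ]
  simp [fourTermRelation, ht0]
  constructor
  · grind
  · grind

/-- The relation R(xy,z) - R(x,yz) - uR(x,y)z + v xR(y,z) = 0 holds because u² = -u and v² = -v; the
tensor factor x records how L is applied to it. -/
theorem isRelation_threeTermCoeff_iff {u v : F} (hu : u = 0 ∨ u = -1) (hv : v = 0 ∨ v = -1)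
    {c : Fin 20 → F} :
    IsRelation (threeTermCoeff u v) c ↔ ∃ x, tensorRelation ![1, -1, -u, v] x = c := by
  constructor
  · intro h
    -- The first tensor factor starts with 1, so x is read off from the block of R(xy,z).
    refine ⟨![c 0, c 1, c 2, c 3], ?_⟩
    simp only [IsRelation, rowPairs, List.forall_mem_cons, List.map, List.sum_cons, List.sum_nil,
      add_zero, threeTermCoeff, funext_iff, Fin.forall_fin_succ] at h ⊢
    rcases hu with rfl | rfl <;> rcases hv with rfl | rfl <;>
      simp [tensorRelation_apply] at h ⊢ <;> grind
  · rintro ⟨x, rfl⟩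
    simp only [IsRelation, rowPairs, List.forall_mem_cons, List.map, List.sum_cons, List.sum_nil,
      add_zero, threeTermCoeff]
    rcases hu with rfl | rfl <;> rcases hv with rfl | rfl <;> simp [tensorRelation_apply]

theorem isRelation_leftTermCoeff_iff {c : Fin 20 → F} :
    IsRelation (leftTermCoeff F) c ↔ ∃ x, tensorRelation ![0, 1, -1, 0] x = c := by
  constructor
  · intro h
    -- Here the relation is R(x,yz) - R(x,y)z = 0, so x is read off from the block of R(x,yz).
    refine ⟨![c 4, c 5, c 6, c 7], ?_⟩
    simp only [IsRelation, rowPairs, List.forall_mem_cons, List.map, List.sum_cons, List.sum_nil,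
      add_zero, leftTermCoeff, funext_iff, Fin.forall_fin_succ] at h ⊢
    simp [tensorRelation_apply] at h ⊢
    grind
  · rintro ⟨x, rfl⟩
    simp only [IsRelation, rowPairs, List.forall_mem_cons, List.map, List.sum_cons, List.sum_nil,
      add_zero, leftTermCoeff]
    simp [tensorRelation_apply]

theorem isRelation_rightTermCoeff_iff {c : Fin 20 → F} :
    IsRelation (rightTermCoeff F) c ↔ ∃ x, tensorRelation ![1, 0, 0, -1] x = c := by
  constructor
  · intro h
    refine ⟨![c 0, c 1, c 2, c 3], ?_⟩
    simp only [IsRelation, rowPairs, List.forall_mem_cons, List.map, List.sum_cons, List.sum_nil,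
      add_zero, rightTermCoeff, funext_iff, Fin.forall_fin_succ] at h ⊢
    simp [tensorRelation_apply] at h ⊢
    grind
  · rintro ⟨x, rfl⟩
    simp only [IsRelation, rowPairs, List.forall_mem_cons, List.map, List.sum_cons, List.sum_nil,
      add_zero, rightTermCoeff]
    simp [tensorRelation_apply]

theorem tensorRelation_eq_zero {v : Fin 4 → F} (hv : v 0 = 1 ∨ v 1 = 1) (x : Fin 4 → F)
    (h : tensorRelation v x = 0) : x = 0 := by
  have h0 (i) : v 0 * x i = 0 := by
    fin_cases i
    exacts [congrFun h 0, congrFun h 1, congrFun h 2, congrFun h 3]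
  have h1 (i) : v 1 * x i = 0 := by
    fin_cases i
    exacts [congrFun h 4, congrFun h 5, congrFun h 6, congrFun h 7]
  rcases hv with hv | hv
  · exact funext fun i => by simpa [hv] using h0 i
  · exact funext fun i => by simpa [hv] using h1 i

theorem rank_of_mem_rank16Coeffs {a : Fin 10 → F} (ha : a ∈ rank16Coeffs F) :
    (consequenceMatrix a).rank = 16 := by
  have key (u v : F) (hu : u = 0 ∨ u = -1) (hv : v = 0 ∨ v = -1) :
      (consequenceMatrix (threeTermCoeff u v)).rank + 4 = 20 :=
    rank_of_isRelation_iff _ (tensorRelation_eq_zero (Or.inl rfl))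
      fun c => isRelation_threeTermCoeff_iff hu hv
  suffices (consequenceMatrix a).rank + 4 = 20 by omega
  rcases ha with rfl | rfl | rfl | rfl | rfl | rfl
  · exact key _ _ (by simp) (by simp)
  · exact key _ _ (by simp) (by simp)
  · exact key _ _ (by simp) (by simp)
  · exact key _ _ (by simp) (by simp)
  · exact rank_of_isRelation_iff _ (tensorRelation_eq_zero (Or.inr rfl))
      fun c => isRelation_leftTermCoeff_iff
  · exact rank_of_isRelation_iff _ (tensorRelation_eq_zero (Or.inl rfl))
      fun c => isRelation_rightTermCoeff_iff

theorem rank_of_isRelation_iff_smul {a : Fin 10 → F} {w : Fin 20 → F} (hw : w ≠ 0)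
    (h : ∀ c, IsRelation a c ↔ ∃ x : F, x • w = c) : (consequenceMatrix a).rank = 19 := by
  suffices (consequenceMatrix a).rank + 1 = 20 by omega
  refine rank_of_isRelation_iff
    ((LinearMap.toSpanSingleton F _ w).comp (LinearMap.proj (0 : Fin 1))) ?_ fun c => ?_
  · intro x hx
    funext i
    rw [Subsingleton.elim i 0]
    exact (smul_eq_zero.1 hx).resolve_right hw
  · rw [h]
    exact ⟨fun ⟨x, hx⟩ => ⟨fun _ => x, hx⟩, fun ⟨x, hx⟩ => ⟨x 0, hx⟩⟩

theorem rank_of_mem_rank19Coeffs {a : Fin 10 → F} (ha : a ∈ rank19Coeffs F) :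
    (consequenceMatrix a).rank = 19 := by
  have hne (t : F) : fourTermRelation t ≠ 0 := fun h => one_ne_zero (congrFun h 3)
  rcases ha with ⟨t, ht, rfl⟩ | ⟨t, ht, rfl⟩
  · exact rank_of_isRelation_iff_smul (hne t) fun c => isRelation_fourTermCoeff_iff ht
  · refine rank_of_isRelation_iff_smul (w := fourTermRelation t ∘ reverseConsequence)
      (fun h => hne t (comp_reverseConsequence_eq_zero h)) fun c => ?_
    have hc : c = (c ∘ reverseConsequence) ∘ reverseConsequence :=
      funext fun j => (congrArg c (reverseConsequence_reverseConsequence j)).symm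
    rw [hc, isRelation_comp_reverse_iff, isRelation_fourTermCoeff_iff ht]
    refine exists_congr fun x => ⟨fun h => by rw [← h]; rfl, fun h => ?_⟩
    funext j
    simpa [reverseConsequence_reverseConsequence] using congrFun h (reverseConsequence j)

/-! ### Case analysis over the normalized coefficient vectors. -/

theorem IsNormalized.coeff_zero {a : Fin 10 → F} (ha : IsNormalized a) : a 0 = 0 ∨ a 0 = 1 := by
  obtain ⟨k, hk, h⟩ := ha
  rcases eq_or_ne k 0 with rfl | hk0
  · exact Or.inr hk
  · exact Or.inl (h 0 (Fin.pos_of_ne_zero hk0))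

theorem IsNormalized.eq_leftTermCoeff {a : Fin 10 → F} (ha : IsNormalized a)
    (h : ∀ k, k ≠ 3 → a k = 0) : a = leftTermCoeff F := by
  obtain ⟨k, hk, -⟩ := ha
  have hk3 : k = 3 := by
    by_contra hne
    exact zero_ne_one ((h k hne).symm.trans hk)
  subst hk3
  funext j
  fin_cases j <;> first | exact hk | exact h _ (by decide)

theorem IsNormalized.eq_rightTermCoeff {a : Fin 10 → F} (ha : IsNormalized a)
    (h : ∀ k, k ≠ 9 → a k = 0) : a = rightTermCoeff F := by
  obtain ⟨k, hk, -⟩ := ha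
  have hk9 : k = 9 := by
    by_contra hne
    exact zero_ne_one ((h k hne).symm.trans hk)
  subst hk9
  funext j
  fin_cases j <;> first | exact hk | exact h _ (by decide)

/-- Stated with a_1 only, so that reversal also settles the case a_4 ≠ 0. -/
theorem IsRelation.eq_zero_or_eq_fourTermCoeff [CharZero F] {a : Fin 10 → F} {c : Fin 20 → F}
    (h : IsRelation a c) (h1 : a 1 ≠ 0) (h0 : a 0 = 0 ∨ a 0 = 1) :
    c = 0 ∨ ∃ t, t ^ 4 = 1 ∧ fourTermCoeff t = a := by
  rcases h0 with h0 | h0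
  · exact Or.inl (h.eq_zero_of_coeff_zero h1 h0)
  · by_cases h4 : a 4 = 0
    · by_contra! hc
      obtain ⟨h5, h6, h7, h8, h9, h2, h3, ht⟩ :=
        not_not.1 fun hn => hc.1 (h.eq_zero_of_one_sided h1 h4 h0 hn)
      refine hc.2 (a 1) ht ?_
      funext k
      fin_cases k <;> simp [fourTermCoeff, *]
    · exact Or.inl (h.eq_zero_of_two_sided h1 h4 h0)

theorem IsRelation.eq_zero [CharZero F] {a : Fin 10 → F} {c : Fin 20 → F}
    (h : IsRelation a c) (ha : IsNormalized a) (h16 : a ∉ rank16Coeffs F)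
    (h19 : a ∉ rank19Coeffs F) : c = 0 := by
  have h0 := ha.coeff_zero
  by_cases h1 : a 1 = 0
  swap
  · exact (h.eq_zero_or_eq_fourTermCoeff h1 h0).resolve_right fun ⟨t, ht, hat⟩ =>
      h19 (Or.inl ⟨t, ht, hat⟩)
  by_cases h4 : a 4 = 0
  swap
  · refine comp_reverseConsequence_eq_zero
      ((h.reverse.eq_zero_or_eq_fourTermCoeff h4 h0).resolve_right fun ⟨t, ht, hat⟩ =>
        h19 (Or.inr ⟨t, ht, ?_⟩))
    dsimp only
    rw [hat]
    exact funext fun k => congrArg a (reverseCoeff_reverseCoeff k)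
  by_contra hc
  obtain ⟨h2, h5, h6, h7, h8⟩ := not_not.1 fun hn => hc (h.eq_zero_of_mixed h1 h4 hn)
  rcases h0 with h0 | h0
  · by_cases h3 : a 3 = 0
    · rw [ha.eq_rightTermCoeff (by simp [Fin.forall_fin_succ, *])] at h16
      simp [rank16Coeffs] at h16
    · by_cases h9 : a 9 = 0
      · rw [ha.eq_leftTermCoeff (by simp [Fin.forall_fin_succ, *])] at h16
        simp [rank16Coeffs] at h16
      · exact hc (h.eq_zero_of_coeff_three_nine h0 h1 h2 h4 h6 h7 h8 h3 h9)
  · have h3 : a 3 = 0 ∨ a 3 = -1 := by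
      by_contra! h3
      exact hc (h.eq_zero_of_coeff_three h0 h1 h2 h4 h6 h7 h8 h3.1 h3.2)
    have h9 : a 9 = 0 ∨ a 9 = -1 := by
      by_contra! h9
      -- Reversal exchanges a_3 with a_9, a_1 with a_4, a_2 with a_7 and a_6 with a_8, which
      -- explains the order of the hypotheses.
      exact hc (comp_reverseConsequence_eq_zero
        (h.reverse.eq_zero_of_coeff_three h0 h4 h7 h1 h8 h2 h6 h9.1 h9.2))
    have hat : a = threeTermCoeff (a 3) (a 9) := by
      funext k
      fin_cases k <;> simp [threeTermCoeff, *]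
    rw [hat] at h16
    rcases h3 with h3 | h3 <;> rcases h9 with h9 | h9 <;> simp [rank16Coeffs, h3, h9] at h16

theorem rank_of_notMem [CharZero F] {a : Fin 10 → F} (ha : IsNormalized a)
    (h16 : a ∉ rank16Coeffs F) (h19 : a ∉ rank19Coeffs F) : (consequenceMatrix a).rank = 20 := by
  refine rank_of_isRelation_iff (n := 0) 0 (fun x _ => Subsingleton.elim _ _) fun c =>
    ⟨fun h => ⟨0, (h.eq_zero ha h16 h19).symm⟩, ?_⟩
  rintro ⟨x, rfl⟩ l _
  simp

theorem isNormalized_of_mem_rank16Coeffs {a : Fin 10 → F} (ha : a ∈ rank16Coeffs F) :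
    IsNormalized a := by
  rcases ha with rfl | rfl | rfl | rfl | rfl | rfl
  · exact ⟨0, rfl, fun j hj => absurd hj (Fin.not_lt_zero j)⟩
  · exact ⟨0, rfl, fun j hj => absurd hj (Fin.not_lt_zero j)⟩
  · exact ⟨0, rfl, fun j hj => absurd hj (Fin.not_lt_zero j)⟩
  · exact ⟨0, rfl, fun j hj => absurd hj (Fin.not_lt_zero j)⟩
  · exact ⟨3, rfl, by simp [Fin.forall_fin_succ, leftTermCoeff]⟩
  · exact ⟨9, rfl, by simp [Fin.forall_fin_succ, rightTermCoeff]⟩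

theorem isNormalized_of_mem_rank19Coeffs {a : Fin 10 → F} (ha : a ∈ rank19Coeffs F) :
    IsNormalized a := by
  rcases ha with ⟨t, -, rfl⟩ | ⟨t, -, rfl⟩
  · exact ⟨0, rfl, fun j hj => absurd hj (Fin.not_lt_zero j)⟩
  · exact ⟨0, rfl, fun j hj => absurd hj (Fin.not_lt_zero j)⟩

theorem rank_eq_sixteen_iff [CharZero F] {a : Fin 10 → F} (ha : IsNormalized a) :
    (consequenceMatrix a).rank = 16 ↔ a ∈ rank16Coeffs F := by
  refine ⟨fun h => ?_, rank_of_mem_rank16Coeffs⟩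
  by_contra h16
  by_cases h19 : a ∈ rank19Coeffs F
  · simp [rank_of_mem_rank19Coeffs h19] at h
  · simp [rank_of_notMem ha h16 h19] at h

theorem rank_eq_nineteen_iff [CharZero F] {a : Fin 10 → F} (ha : IsNormalized a) :
    (consequenceMatrix a).rank = 19 ↔ a ∈ rank19Coeffs F := by
  refine ⟨fun h => ?_, rank_of_mem_rank19Coeffs⟩
  by_contra h19
  by_cases h16 : a ∈ rank16Coeffs F
  · simp [rank_of_mem_rank16Coeffs h16] at h
  · simp [rank_of_notMem ha h16 h19] at h

/-! ### Translation from coefficient vectors to identities, and counting. -/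

theorem monomials23_injective : Function.Injective monomials23 := by
  unfold Function.Injective
  decide +kernel

theorem identity23_injective : Function.Injective (identity23 : (Fin 10 → F) → OpPoly F) := by
  intro a b hab
  funext k
  have h := DFunLike.congr_fun hab (monomials23 k)
  rwa [show identity23 a = polyOf a monomials23 from rfl,
    show identity23 b = polyOf b monomials23 from rfl, polyOf_apply, polyOf_apply,
    Finset.sum_eq_single_of_mem k (Finset.mem_univ k), if_pos rfl,
    Finset.sum_eq_single_of_mem k (Finset.mem_univ k), if_pos rfl] at h
  · exact fun l _ hl => if_neg fun h => hl (monomials23_injective h)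
  · exact fun l _ hl => if_neg fun h => hl (monomials23_injective h)

theorem identity23_threeTermCoeff (u v : F) : identity23 (threeTermCoeff u v) =
    mono F (op (op (op (arg * arg)))) + u • mono F (op (op (op arg)) * arg) +
      v • mono F (arg * op (op (op arg))) := by
  simp [identity23, Fin.sum_univ_succ, monomials23, threeTermCoeff, mono, add_assoc]

theorem identity23_leftTermCoeff :
    identity23 (leftTermCoeff F) = mono F (op (op (op arg)) * arg) := by
  simp [identity23, Fin.sum_univ_succ, monomials23, leftTermCoeff, mono]

theorem identity23_rightTermCoeff :
    identity23 (rightTermCoeff F) = mono F (arg * op (op (op arg))) := by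
  simp [identity23, Fin.sum_univ_succ, monomials23, rightTermCoeff, mono]

theorem identity23_fourTermCoeff (t : F) :
    identity23 (fourTermCoeff t) = fourTermLeft t (t ^ 2) (t ^ 3) := by
  simp [identity23, Fin.sum_univ_succ, monomials23, fourTermCoeff, fourTermLeft, mono, add_assoc]

theorem identity23_fourTermCoeff_comp_reverseCoeff (t : F) :
    identity23 (fourTermCoeff t ∘ reverseCoeff) = fourTermRight t (t ^ 2) (t ^ 3) := by
  simp [identity23, Fin.sum_univ_succ, monomials23, fourTermCoeff, reverseCoeff, fourTermRight,
    mono, add_assoc]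

theorem rank16Identities_eq : rank16Identities F = identity23 '' rank16Coeffs F := by
  simp only [rank16Coeffs, Set.image_insert_eq, Set.image_singleton, identity23_threeTermCoeff,
    identity23_leftTermCoeff, identity23_rightTermCoeff, rank16Identities, zero_smul, add_zero,
    neg_smul, one_smul, ← sub_eq_add_neg, sub_sub]

theorem pow_four_eq_one_iff {t : F} : t ^ 4 = 1 ↔ t = 1 ∨ t = -1 ∨ t ^ 2 = -1 := by
  constructor
  · intro h
    have h' : (t ^ 2 - 1) * (t ^ 2 + 1) = 0 := by linear_combination h
    rcases mul_eq_zero.1 h' with h' | h'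
    · have hsq : t ^ 2 = 1 ^ 2 := by linear_combination h'
      rcases sq_eq_sq_iff_eq_or_eq_neg.1 hsq with h | h <;> simp [h]
    · exact Or.inr (Or.inr (eq_neg_of_add_eq_zero_left h'))
  · rintro (rfl | rfl | h)
    · ring
    · ring
    · linear_combination (t ^ 2 - 1) * h

theorem rank19Identities_eq : rank19Identities F = identity23 '' rank19Coeffs F := by
  have h2 : (-1 : F) ^ 2 = 1 := by ring
  have h3 : (-1 : F) ^ 3 = -1 := by ring
  have hi {i : F} (h : i ^ 2 = -1) : i ^ 3 = -i := by linear_combination i * h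
  have hn {i : F} (h : i ^ 2 = -1) : (-i) ^ 2 = -1 := by linear_combination h
  ext P
  simp only [rank19Coeffs, Set.image_union, Set.image_image, identity23_fourTermCoeff,
    identity23_fourTermCoeff_comp_reverseCoeff, Set.mem_union, Set.mem_image, Set.mem_ofPred_eq]
  constructor
  · rintro ((rfl | rfl | rfl | rfl) | ⟨i, h, rfl | rfl | rfl | rfl⟩)
    · exact Or.inr ⟨1, by simp, by simp⟩
    · exact Or.inr ⟨-1, by rw [pow_four_eq_one_iff]; simp, by rw [h2, h3]⟩
    · exact Or.inl ⟨1, by simp, by simp⟩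
    · exact Or.inl ⟨-1, by rw [pow_four_eq_one_iff]; simp, by rw [h2, h3]⟩
    · exact Or.inr ⟨i, by rw [pow_four_eq_one_iff]; simp [h], by rw [hi h, h]⟩
    · exact Or.inr ⟨-i, by rw [pow_four_eq_one_iff]; simp [h], by rw [hi (hn h), hn h, neg_neg]⟩
    · exact Or.inl ⟨i, by rw [pow_four_eq_one_iff]; simp [h], by rw [hi h, h]⟩
    · exact Or.inl ⟨-i, by rw [pow_four_eq_one_iff]; simp [h], by rw [hi (hn h), hn h, neg_neg]⟩
  · rintro (⟨t, ht, rfl⟩ | ⟨t, ht, rfl⟩) <;>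
      rcases pow_four_eq_one_iff.1 ht with rfl | rfl | h
    · simp [rank19Identities]
    · simp [rank19Identities, h2, h3]
    · exact Or.inr ⟨t, h, by simp [h, hi h]⟩
    · simp [rank19Identities]
    · simp [rank19Identities, h2, h3]
    · exact Or.inr ⟨t, h, by simp [h, hi h]⟩

theorem identity23_mem_rank16Identities_iff {a : Fin 10 → F} :
    identity23 a ∈ rank16Identities F ↔ a ∈ rank16Coeffs F := by
  rw [rank16Identities_eq, identity23_injective.mem_set_image]

theorem identity23_mem_rank19Identities_iff {a : Fin 10 → F} :
    identity23 a ∈ rank19Identities F ↔ a ∈ rank19Coeffs F := by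
  rw [rank19Identities_eq, identity23_injective.mem_set_image]

theorem ncard_rank16Coeffs : (rank16Coeffs F).ncard = 6 := by
  have hinj {u v u' v' : F} :
      threeTermCoeff u v = threeTermCoeff u' v' ↔ u = u' ∧ v = v' :=
    ⟨fun h => ⟨congrFun h 3, congrFun h 9⟩, fun ⟨h, h'⟩ => by rw [h, h']⟩
  have hl (u v : F) : threeTermCoeff u v ≠ leftTermCoeff F := fun h =>
    one_ne_zero (congrFun h 0)
  have hr (u v : F) : threeTermCoeff u v ≠ rightTermCoeff F := fun h =>
    one_ne_zero (congrFun h 0)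
  have hlr : leftTermCoeff F ≠ rightTermCoeff F := fun h => one_ne_zero (congrFun h 3)
  rw [rank16Coeffs, Set.ncard_insert_of_notMem, Set.ncard_insert_of_notMem,
    Set.ncard_insert_of_notMem, Set.ncard_insert_of_notMem, Set.ncard_pair hlr]
  all_goals simp [hinj, hl, hr]

theorem ncard_rank19Coeffs [CharZero F] (hF : IsSquare (-1 : F)) :
    (rank19Coeffs F).ncard = 8 := by
  obtain ⟨i, hi⟩ := hF
  have hroots : {t : F | t ^ 4 = 1} = {1, -1, i, -i} := by
    ext t
    have h : t ^ 2 = -1 ↔ t = i ∨ t = -i := by rw [hi, ← sq, sq_eq_sq_iff_eq_or_eq_neg]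
    simp [pow_four_eq_one_iff, h]
  have h1 : (1 : F) ≠ -1 := fun h => two_ne_zero (α := F) (by linear_combination h)
  have hi1 : i ≠ 1 := by
    rintro rfl
    simp [h1.symm] at hi
  have hi2 : i ≠ -1 := by
    rintro rfl
    simp [h1.symm] at hi
  have hi0 : i ≠ 0 := by
    rintro rfl
    simp at hi
  have hi3 : i ≠ -i := fun h => hi0 (by
    have : 2 * i = 0 := by linear_combination h
    simpa using this)
  have hcard : {t : F | t ^ 4 = 1}.ncard = 4 := by
    rw [hroots, Set.ncard_insert_of_notMem, Set.ncard_insert_of_notMem, Set.ncard_pair hi3]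
    all_goals grind
  have hfin : {t : F | t ^ 4 = 1}.Finite := by
    rw [hroots]
    exact Set.toFinite _
  have hinj : Function.Injective (fourTermCoeff : F → Fin 10 → F) := fun s t h => congrFun h 1
  have hinj' : Function.Injective fun t : F => fourTermCoeff t ∘ reverseCoeff :=
    fun s t h => congrFun h 4
  have hdisj : Disjoint ((fourTermCoeff : F → Fin 10 → F) '' {t | t ^ 4 = 1})
      ((fun t => fourTermCoeff t ∘ reverseCoeff) '' {t | t ^ 4 = 1}) := by
    rw [Set.disjoint_left]
    rintro _ ⟨s, hs, rfl⟩ ⟨t, -, h⟩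
    -- The coefficient of L²(L(x)y) is s in the left family and 0 in the right one.
    have hs0 : (0 : F) = s := congrFun h 1
    rw [Set.mem_ofPred_eq, ← hs0] at hs
    simp at hs
  rw [rank19Coeffs, Set.ncard_union_eq hdisj (hfin.image _) (hfin.image _),
    Set.ncard_image_of_injective _ hinj, Set.ncard_image_of_injective _ hinj', hcard]

end Coefficients

theorem theorem1 (F : Type*) [Field F] [CharZero F] :
    -- the size of the matrix of consequences
    (Nat.card (operatorMonomials 3 4) = 105 ∧
      Nat.card (consequences 2 (genericIdentity23 F)) = 20) ∧
    -- the rank of the matrix for every normalized coefficient vector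
    (∀ a : Fin 10 → F, IsNormalized a →
      ((consequenceMatrix a).rank = 16 ↔ identity23 a ∈ rank16Identities F) ∧
      ((consequenceMatrix a).rank = 19 ↔ identity23 a ∈ rank19Identities F) ∧
      (identity23 a ∉ rank16Identities F → identity23 a ∉ rank19Identities F →
        (consequenceMatrix a).rank = 20)) ∧
    -- the numbers of identities
    {a : Fin 10 → F | IsNormalized a ∧ (consequenceMatrix a).rank = 16}.ncard = 6 ∧
    (IsSquare (-1 : F) →
      {a : Fin 10 → F | IsNormalized a ∧ (consequenceMatrix a).rank = 19}.ncard = 8) := by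
  refine ⟨⟨card_operatorMonomials_three_four, card_consequences⟩, fun a ha => ?_, ?_, fun hF => ?_⟩
  · rw [identity23_mem_rank16Identities_iff, identity23_mem_rank19Identities_iff]
    exact ⟨rank_eq_sixteen_iff ha, rank_eq_nineteen_iff ha, rank_of_notMem ha⟩
  · rw [← ncard_rank16Coeffs (F := F)]
    congr 1
    ext a
    exact ⟨fun h => (rank_eq_sixteen_iff h.1).1 h.2, fun h =>
      ⟨isNormalized_of_mem_rank16Coeffs h, rank_of_mem_rank16Coeffs h⟩⟩
  · rw [← ncard_rank19Coeffs hF]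
    congr 1
    ext a
    exact ⟨fun h => (rank_eq_nineteen_iff h.1).1 h.2, fun h =>
      ⟨isNormalized_of_mem_rank19Coeffs h, rank_of_mem_rank19Coeffs h⟩⟩
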